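/- **Theorem.** Let $(R,\mathfrak m)$ be a Noetherian local ring of dimension $d$, and let $T$ be a commutative $R$-algebra equipped with a value map, i.e. a map $v:T\to\mathbb R\cup\{\infty\}$ with $v(ab)=v(a)+v(b)$, $v(a+b)\ge\min\{v(a),v(b)\}$ for all $a,b\in T$ and $v(0)=\infty$. Call a $T$-module $N$ *almost zero* if for every $m\in N$ and every real $\epsilon>0$ there is $b\in T$ with $bm=0$ and $v(b)<\epsilon$. Let $x_1,\dots,x_n$ be a sequence in $R$ with $\sqrt{(x_1,\dots,x_n)}=\mathfrak m$ (for instance a generating sequence of $\mathfrak m$ or a system of parameters of $R$), and for a $T$-module $N$ let $H^i_{\mathfrak m}(N)$ be the $i$-th cohomology module of the Čech complex of $N$ with respect to $x_1,\dots,x_n$. Call $N$ *almost Cohen–Macaulay* over $R$ if $H^i_{\mathfrak m}(N)$ is almost zero for all $i\neq d$ and $N/\mathfrak mN$ is not almost zero. Suppose that $T$ is almost Cohen–Macaulay over $R$, and let $M$ be an almost faithfully flat $T$-module, i.e. $\operatorname{Tor}^T_i(M,N)$ is almost zero for all $i>0$ and all $T$-modules $N$, and, for every $T$-module $N$, if $M\otimes_TN$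 is almost zero then $N$ is almost zero. Then $M$ is almost Cohen–Macaulay over $R$: $H^i_{\mathfrak m}(M)$ is almost zero for all $i\ne d$, and $M/\mathfrak mM$ is not almost zero. -/

import Mathlib

universe u w

/-- A (semi-)value map `v : T → ℝ ∪ {∞}` on a commutative ring. Neither `v 1 = 0` nor nonnegativity
is required, and nonzero elements may have value `∞`. -/
structure ValueMap (T : Type u) [CommRing T] where
  toFun : T → WithTop ℝ
  map_mul' : ∀ a b, toFun (a * b) = toFun a + toFun b
  map_add' : ∀ a b, min (toFun a) (toFun b) ≤ toFun (a + b)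
  map_zero' : toFun 0 = ⊤

instance {T : Type u} [CommRing T] : CoeFun (ValueMap T) (fun _ => T → WithTop ℝ) :=
  ⟨ValueMap.toFun⟩

/-- `M` is almost zero with respect to `v`: every element of `M` is killed by elements of `T` of
arbitrarily small value. -/
def IsAlmostZero {T : Type u} [CommRing T] (v : ValueMap T)
    (M : Type w) [AddCommGroup M] [Module T M] : Prop :=
  ∀ m : M, ∀ ε : ℝ, 0 < ε → ∃ b : T, b • m = 0 ∧ v b < (ε : WithTop ℝ)

/-- `M` is almost flat: `Tor_i^T(M, N)` is almost zero for all `i > 0` and all `T`-modules `N`. -/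
def IsAlmostFlat {T : Type u} [CommRing T] (v : ValueMap T)
    (M : Type u) [AddCommGroup M] [Module T M] : Prop :=
  ∀ (N : ModuleCat.{u} T) (i : ℕ), 0 < i →
    IsAlmostZero v
      (((CategoryTheory.Tor (ModuleCat.{u} T) i).obj (ModuleCat.of T M)).obj N : ModuleCat.{u} T)

/-- `M` is almost faithfully flat: it is almost flat, and `N` is almost zero whenever `M ⊗ N` is. -/
def IsAlmostFaithfullyFlat {T : Type u} [CommRing T] (v : ValueMap T)
    (M : Type u) [AddCommGroup M] [Module T M] : Prop :=
  IsAlmostFlat v M ∧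
    ∀ (N : Type u) [AddCommGroup N] [Module T N],
      IsAlmostZero v (TensorProduct T M N) → IsAlmostZero v N

section Cech

variable {T : Type u} [CommRing T] {n : ℕ}

/-- The localization `M_a = M[1/a]`. -/
abbrev LocAway (a : T) (M : Type w) [AddCommGroup M] [Module T M] : Type (max u w) :=
  LocalizedModule (Submonoid.powers a) M

theorem isUnit_of_dvd_locAway {a b : T} (h : a ∣ b) (M : Type w) [AddCommGroup M] [Module T M]
    (s : Submonoid.powers a) :
    IsUnit (algebraMap T (Module.End T (LocAway b M)) s) := by
  obtain ⟨s, k, rfl⟩ := s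
  obtain ⟨c, rfl⟩ := h
  have hb := IsLocalizedModule.map_units (S := Submonoid.powers (a * c))
    (LocalizedModule.mkLinearMap (Submonoid.powers (a * c)) M)
    ⟨a * c, Submonoid.mem_powers _⟩
  simp only [map_mul, map_pow] at hb ⊢
  exact ((Commute.isUnit_mul_iff (Algebra.commutes a
    (algebraMap T (Module.End T (LocAway (a * c) M)) c))).1 hb).1.pow k

/-- For `a ∣ b`, the canonical `T`-linear map `M_a → M_b`, `m / 1 ↦ m / 1`. -/
noncomputable def locAwayMap {a b : T} (h : a ∣ b) (M : Type w) [AddCommGroup M] [Module T M] :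
    LocAway a M →ₗ[T] LocAway b M :=
  LocalizedModule.lift (Submonoid.powers a)
    (LocalizedModule.mkLinearMap (Submonoid.powers b) M) (isUnit_of_dvd_locAway h M)

/-- The degree-`p` term `⨁_{i₁ < ⋯ < i_p} M_{y_{i₁} ⋯ y_{i_p}}` of the Čech complex of `M` with
respect to the sequence `y`. -/
abbrev CechTerm (y : Fin n → T) (M : Type w) [AddCommGroup M] [Module T M] (p : ℕ) :
    Type (max u w) :=
  (s : {s : Finset (Fin n) // s.card = p}) → LocAway (∏ i ∈ s.1, y i) M

/-- The Čech differential: on the component `s = {j₀ < ⋯ < j_p}` it is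
`∑ k, (-1) ^ k • (image of the component at s \ {j_k})`. -/
noncomputable def cechDiff (y : Fin n → T) (M : Type w) [AddCommGroup M] [Module T M] (p : ℕ) :
    CechTerm y M p →ₗ[T] CechTerm y M (p + 1) :=
  LinearMap.pi fun s => ∑ i ∈ s.1.attach,
    (-1 : T) ^ (s.1.filter (· < i.1)).card •
      (locAwayMap (Finset.prod_dvd_prod_of_subset _ _ y (Finset.erase_subset i.1 s.1)) M ∘ₗ
        LinearMap.proj (φ := fun t : {t : Finset (Fin n) // t.card = p} =>
            LocAway (∏ i ∈ t.1, y i) M)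
          ⟨s.1.erase i.1, by rw [Finset.card_erase_of_mem i.2, s.2, Nat.add_sub_cancel]⟩)

/-- The coboundaries of the Čech complex in degree `p`. -/
noncomputable def cechBoundaries (y : Fin n → T) (M : Type w) [AddCommGroup M] [Module T M] :
    (p : ℕ) → Submodule T (CechTerm y M p)
  | 0 => ⊥
  | p + 1 => LinearMap.range (cechDiff y M p)

/-- The `p`-th cohomology `ker d^p / im d^{p-1}` of the Čech complex of `M` with respect to `y`,
as a `T`-module. -/
abbrev CechCohomology (y : Fin n → T) (M : Type w) [AddCommGroup M] [Module T M] (p : ℕ) :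
    Type (max u w) :=
  LinearMap.ker (cechDiff y M p) ⧸
    (cechBoundaries y M p).submoduleOf (LinearMap.ker (cechDiff y M p))

theorem locAwayMap_comp {a b c : T} (h : a ∣ b) (h' : b ∣ c) (M : Type w)
    [AddCommGroup M] [Module T M] (z : LocAway a M) :
    locAwayMap h' M (locAwayMap h M z) = locAwayMap (h.trans h') M z := by
  have : locAwayMap h' M ∘ₗ locAwayMap h M = locAwayMap (h.trans h') M := by
    apply IsLocalizedModule.ext (Submonoid.powers a)
      (LocalizedModule.mkLinearMap (Submonoid.powers a) M) (isUnit_of_dvd_locAway (h.trans h') M)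
    ext m
    simp [locAwayMap, LocalizedModule.lift_mk]
  exact LinearMap.congr_fun this z

theorem cechDiff_apply (y : Fin n → T) (M : Type w) [AddCommGroup M] [Module T M] (p : ℕ)
    (f : CechTerm y M p) (s : {s : Finset (Fin n) // s.card = p + 1}) :
    cechDiff y M p f s = ∑ i ∈ s.1.attach, (-1 : T) ^ (s.1.filter (· < i.1)).card •
      locAwayMap (Finset.prod_dvd_prod_of_subset _ _ y (Finset.erase_subset i.1 s.1)) M
        (f ⟨s.1.erase i.1, by rw [Finset.card_erase_of_mem i.2, s.2, Nat.add_sub_cancel]⟩) := by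
  simp [cechDiff, LinearMap.sum_apply]

/-- The Čech differentials form a complex. -/
theorem cechDiff_cechDiff (y : Fin n → T) (M : Type w) [AddCommGroup M] [Module T M] (p : ℕ)
    (f : CechTerm y M p) : cechDiff y M (p + 1) (cechDiff y M p f) = 0 := by
  funext s
  have key : ∀ (t t' : {t : Finset (Fin n) // t.card = p}) (b : T)
      (h : ∏ i ∈ t.1, y i ∣ b) (h' : ∏ i ∈ t'.1, y i ∣ b), t = t' →
      locAwayMap h M (f t) = locAwayMap h' M (f t') := by
    rintro t t' b h h' rfl
    rfl
  have sgn : ∀ i ∈ s.1, ∀ j ∈ s.1, i < j →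
      (s.1.filter (· < j)).card = ((s.1.erase i).filter (· < j)).card + 1 ∧
      ((s.1.erase j).filter (· < i)).card = (s.1.filter (· < i)).card := by
    intro i hi j hj hij
    constructor
    · rw [Finset.filter_erase, Finset.card_erase_add_one]
      exact Finset.mem_filter.2 ⟨hi, hij⟩
    · rw [Finset.filter_erase, Finset.erase_eq_of_notMem]
      intro h
      exact absurd (Finset.mem_filter.1 h).2 (not_lt.2 hij.le)
  simp only [cechDiff_apply, map_sum, map_smul, Finset.smul_sum, locAwayMap_comp, smul_smul,
    ← pow_add, Pi.zero_apply]
  rw [Finset.sum_sigma']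
  refine Finset.sum_involution
    (fun q _ => ⟨⟨q.2.1, (Finset.mem_erase.1 q.2.2).2⟩,
      ⟨q.1.1, Finset.mem_erase.2 ⟨(Finset.mem_erase.1 q.2.2).1.symm, q.1.2⟩⟩⟩)
    ?_ ?_ ?_ ?_
  · rintro ⟨⟨i, hi⟩, ⟨j, hj⟩⟩ -
    have hj' := Finset.mem_erase.1 hj
    dsimp only
    have hc : ((s.1.erase i).erase j).card = p := by
      rw [Finset.card_erase_of_mem hj, Finset.card_erase_of_mem hi, s.2]
      rfl
    rw [key ⟨(s.1.erase j).erase i, _⟩ ⟨(s.1.erase i).erase j, hc⟩ _ _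
      (Finset.prod_dvd_prod_of_subset _ _ y
        ((Finset.erase_subset _ _).trans (Finset.erase_subset _ _)))
      (Subtype.ext Finset.erase_right_comm), ← add_smul]
    rw [show ((-1 : T) ^ ((s.1.filter (· < i)).card + ((s.1.erase i).filter (· < j)).card) +
      (-1 : T) ^ ((s.1.filter (· < j)).card + ((s.1.erase j).filter (· < i)).card)) = 0 from ?_,
      zero_smul]
    rcases lt_or_gt_of_ne hj'.1 with h | h
    · obtain ⟨h1, h2⟩ := sgn j hj'.2 i hi h
      rw [h1, h2]
      ring
    · obtain ⟨h1, h2⟩ := sgn i hi j hj'.2 h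
      rw [h1, h2]
      ring
  · rintro ⟨⟨i, hi⟩, ⟨j, hj⟩⟩ - - h
    have h1 := congrArg (fun q => q.1.1) h
    exact (Finset.mem_erase.1 hj).1 h1
  · intro q _
    simp
  · rintro ⟨⟨i, hi⟩, ⟨j, hj⟩⟩ -
    rfl

end Cech

/-- The `T`-module `M` is almost Cohen-Macaulay over the local ring `R`: writing `H^i_𝔪(M)` for the
cohomology of the Čech complex of `M` with respect to a sequence `x` generating the maximal ideal
`𝔪` of `R` up to radical, `H^i_𝔪(M)` is almost zero for all `i ≠ dim R`, and `M/𝔪M` is not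
almost zero. -/
def IsAlmostCohenMacaulay (R : Type w) [CommRing R] [IsLocalRing R] {T : Type u} [CommRing T]
    [Algebra R T] (v : ValueMap T) {n : ℕ} (x : Fin n → R)
    (M : Type u) [AddCommGroup M] [Module T M] : Prop :=
  (∀ i : ℕ, (i : WithBot ℕ∞) ≠ ringKrullDim R →
    IsAlmostZero v (CechCohomology (fun j => algebraMap R T (x j)) M i)) ∧
  ¬ IsAlmostZero v
    (M ⧸ ((IsLocalRing.maximalIdeal R).map (algebraMap R T) • (⊤ : Submodule T M)))

/-! The Čech complex of `M` is `M ⊗ -` applied to that of `T`, and `M/𝔪M` is `M ⊗ T/𝔪T`. The second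
identification and almost faithfulness show that `M/𝔪M` cannot be almost zero. For the first, `M ⊗
-` must preserve almost exactness of `A → B → C` (`IsAlmostFlat.almost_exact_lTensor`). Almost
vanishing of `Tor₁` makes `M ⊗ im g → M ⊗ C` almost injective, so a small multiple of a cycle comes
from `M ⊗ ker g`. As `ker g / im f` is almost zero, so is its tensor product with `M`, and a further
small multiple is a boundary. -/

open CategoryTheory TensorProduct LinearMap

/-! ### Almost zero modules -/

section AlmostZero

variable {T : Type u} [CommRing T] {v : ValueMap T}

theorem ValueMap.map_mul_lt (v : ValueMap T) {a b : T} {ε : ℝ}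
    (ha : v a < ((ε / 2 : ℝ) : WithTop ℝ)) (hb : v b < ((ε / 2 : ℝ) : WithTop ℝ)) :
    v (a * b) < (ε : WithTop ℝ) := by
  rw [v.map_mul']
  change v.toFun a < _ at ha
  change v.toFun b < _ at hb
  generalize v.toFun a = s at *
  generalize v.toFun b = t at *
  obtain ⟨s, rfl⟩ := WithTop.ne_top_iff_exists.1 ha.ne_top
  obtain ⟨t, rfl⟩ := WithTop.ne_top_iff_exists.1 hb.ne_top
  rw [← WithTop.coe_add]
  rw [WithTop.coe_lt_coe] at *
  linarith

theorem IsAlmostZero.of_surjective {M N : Type*} [AddCommGroup M] [Module T M]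
    [AddCommGroup N] [Module T N] (h : IsAlmostZero v M) (f : M →ₗ[T] N)
    (hf : Function.Surjective f) : IsAlmostZero v N := by
  intro n ε hε
  obtain ⟨m, rfl⟩ := hf n
  obtain ⟨b, hb, hv⟩ := h m ε hε
  exact ⟨b, by rw [← map_smul, hb, map_zero], hv⟩

/-- An annihilator of `n` kills `m ⊗ n`; for a sum, the product of annihilators of the two summands
works, each taken with bound `ε / 2`. -/
theorem IsAlmostZero.tensorProduct {M N : Type*} [AddCommGroup M] [Module T M]
    [AddCommGroup N] [Module T N] (h : IsAlmostZero v N) : IsAlmostZero v (M ⊗[T] N) := by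
  intro z
  induction z with
  | zero =>
    intro ε hε
    -- The witness `1` is not available: `v 1` may be `∞`, in which case every value is `∞` and not
    -- even the zero module is almost zero.
    obtain ⟨b, -, hv⟩ := h 0 ε hε
    exact ⟨b, smul_zero b, hv⟩
  | tmul m n =>
    intro ε hε
    obtain ⟨b, hb, hv⟩ := h n ε hε
    exact ⟨b, by rw [← TensorProduct.tmul_smul, hb, TensorProduct.tmul_zero], hv⟩
  | add z w hz hw =>
    intro ε hε
    obtain ⟨b, hb, hbv⟩ := hz (ε / 2) (half_pos hε)
    obtain ⟨c, hc, hcv⟩ := hw (ε / 2) (half_pos hε)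
    refine ⟨b * c, ?_, v.map_mul_lt hbv hcv⟩
    rw [smul_add, mul_smul, mul_smul, hc, smul_zero, smul_comm, hb, smul_zero, add_zero]

/-- The quotient of a submodule `K` by a submodule `B` is almost zero exactly when every element
of `K` is almost in `B`. -/
theorem isAlmostZero_quotient_submoduleOf_iff {M : Type*} [AddCommGroup M] [Module T M]
    (K B : Submodule T M) :
    IsAlmostZero v (K ⧸ B.submoduleOf K) ↔
      ∀ z ∈ K, ∀ ε : ℝ, 0 < ε → ∃ b : T, b • z ∈ B ∧ v b < (ε : WithTop ℝ) := by
  have key (z : K) (b : T) :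
      b • (Submodule.Quotient.mk z : K ⧸ B.submoduleOf K) = 0 ↔ b • (z : M) ∈ B := by
    rw [← Submodule.Quotient.mk_smul, Submodule.Quotient.mk_eq_zero, Submodule.submoduleOf, Submodule.mem_comap, Submodule.subtype_apply,
      Submodule.coe_smul]
  constructor
  · intro h z hz ε hε
    obtain ⟨b, hb, hv⟩ := h (Submodule.Quotient.mk ⟨z, hz⟩) ε hε
    exact ⟨b, (key _ _).1 hb, hv⟩
  · intro h q ε hε
    obtain ⟨z, rfl⟩ := Submodule.Quotient.mk_surjective _ q
    obtain ⟨b, hb, hv⟩ := h z z.2 ε hε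
    exact ⟨b, (key _ _).2 hb, hv⟩

theorem CategoryTheory.ShortComplex.exists_smul_mem_range_of_isAlmostZero_homology
    (S : ShortComplex (ModuleCat.{u} T)) (h : IsAlmostZero v S.homology) (z : S.X₂)
    (hz : S.g.hom z = 0) (ε : ℝ) (hε : 0 < ε) :
    ∃ b : T, b • z ∈ range S.f.hom ∧ v b < (ε : WithTop ℝ) := by
  have h' : IsAlmostZero v (ker S.g.hom ⧸ range S.moduleCatToCycles) :=
    h.of_surjective S.moduleCatHomologyIso.toLinearEquiv.toLinearMap
      S.moduleCatHomologyIso.toLinearEquiv.surjective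
  obtain ⟨b, hb, hv⟩ := h' (Submodule.Quotient.mk ⟨z, hz⟩) ε hε
  refine ⟨b, ?_, hv⟩
  rw [← Submodule.Quotient.mk_smul, Submodule.Quotient.mk_eq_zero] at hb
  obtain ⟨y, hy⟩ := hb
  exact ⟨y, congrArg Subtype.val hy⟩

end AlmostZero

/-! ### Almost flatness and almost exactness -/

section AlmostFlat

variable {T : Type u} [CommRing T] {v : ValueMap T} {M : Type u} [AddCommGroup M] [Module T M]

/-- Almost vanishing of `Tor₁`, spelled out on a projective resolution `P₂ → P₁ → P₀ → N`. -/
theorem IsAlmostFlat.exists_resolution (hM : IsAlmostFlat v M) (N : Type u) [AddCommGroup N]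
    [Module T N] :
    ∃ (P₀ P₁ P₂ : ModuleCat.{u} T) (d₂ : P₂ →ₗ[T] P₁) (d₁ : P₁ →ₗ[T] P₀) (π : P₀ →ₗ[T] N),
      Module.Projective T P₀ ∧ Function.Surjective π ∧ Function.Exact d₁ π ∧ d₁ ∘ₗ d₂ = 0 ∧
      ∀ z : M ⊗[T] P₁, d₁.lTensor M z = 0 → ∀ ε : ℝ, 0 < ε →
        ∃ b : T, b • z ∈ range (d₂.lTensor M) ∧ v b < (ε : WithTop ℝ) := by
  let P := projectiveResolution (ModuleCat.of T N)
  let F := (MonoidalCategory.tensoringLeft (ModuleCat.{u} T)).obj (ModuleCat.of T M)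
  let K := (F.mapHomologicalComplex (ComplexShape.down ℕ)).obj P.complex
  refine ⟨P.complex.X 0, P.complex.X 1, P.complex.X 2, (P.complex.d 2 1).hom,
    (P.complex.d 1 0).hom, (P.π.f 0).hom, ?_, ?_, ?_, ?_, ?_⟩
  · have := P.projective 0
    exact (IsProjective.iff_projective _).2 this
  · exact (ModuleCat.epi_iff_surjective _).1 (inferInstanceAs (Epi (P.π.f 0)))
  · exact (ShortComplex.ShortExact.moduleCat_exact_iff_function_exact _).1 P.exact₀
  · rw [← ModuleCat.hom_comp, P.complex.d_comp_d]
    rfl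
  · let e : ((Tor (ModuleCat.{u} T) 1).obj (ModuleCat.of T M)).obj (ModuleCat.of T N) ≅
        (K.sc' 2 1 0).homology :=
      P.isoLeftDerivedObj F 1 ≪≫ K.homologyIsoSc' 2 1 0 (by simp) (by simp)
    exact (K.sc' 2 1 0).exists_smul_mem_range_of_isAlmostZero_homology
      ((hM (ModuleCat.of T N) 1 one_pos).of_surjective e.toLinearEquiv.toLinearMap
        e.toLinearEquiv.surjective)

/-- Tensoring an injective map with an almost flat module gives an almost injective map. -/
theorem IsAlmostFlat.exists_smul_eq_zero_of_lTensor_eq_zero (hM : IsAlmostFlat v M)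
    {A B : Type u} [AddCommGroup A] [Module T A] [AddCommGroup B] [Module T B] (f : A →ₗ[T] B)
    (hf : Function.Injective f) (x : M ⊗[T] A) (hx : f.lTensor M x = 0) (ε : ℝ) (hε : 0 < ε) :
    ∃ b : T, b • x = 0 ∧ v b < (ε : WithTop ℝ) := by
  obtain ⟨P₀, P₁, P₂, d₂, d₁, π, hproj, hπ, hex, hd, hTor⟩ := hM.exists_resolution (B ⧸ range f)
  -- The resolution of `B / f(A)` is compared with `A → B`: the lifts `φ₀ : P₀ → B` and `φ₁ : P₁ →
  -- A` form a chain map. This replaces the long exact sequence of `Tor`.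
  obtain ⟨φ₀, hφ₀⟩ := Module.projective_lifting_property (range f).mkQ π (Submodule.mkQ_surjective _)
  have hφ₀' (p : P₀) : Submodule.Quotient.mk (φ₀ p) = π p := LinearMap.congr_fun hφ₀ p
  have hmem (p : P₁) : φ₀ (d₁ p) ∈ range f := by
    rw [← Submodule.Quotient.mk_eq_zero, hφ₀']
    exact hex.apply_apply_eq_zero p
  let φ₁ : P₁ →ₗ[T] A :=
    (LinearEquiv.ofInjective f hf).symm ∘ₗ (φ₀ ∘ₗ d₁).codRestrict (range f) hmem
  have hφ₁ (p : P₁) : f (φ₁ p) = φ₀ (d₁ p) := by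
    rw [← LinearEquiv.ofInjective_apply (h := hf)]
    simp [φ₁]
  have hcomp : φ₁ ∘ₗ d₂ = 0 := by
    ext p
    apply hf
    have : d₁ (d₂ p) = 0 := LinearMap.congr_fun hd p
    simp [hφ₁, this]
  -- `P₁ → A × P₀ → B → 0` is exact
  let j : P₁ →ₗ[T] A × P₀ := φ₁.prod (-d₁)
  let q : A × P₀ →ₗ[T] B := f.coprod φ₀
  have hq : Function.Surjective q := by
    intro b
    obtain ⟨p, hp⟩ := hπ (Submodule.Quotient.mk b)
    have : b - φ₀ p ∈ range f := by
      rw [← Submodule.Quotient.mk_eq_zero, Submodule.Quotient.mk_sub, hφ₀', hp, sub_self]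
    obtain ⟨a, ha⟩ := this
    exact ⟨(a, p), by simp [q, ha]⟩
  have hjq : Function.Exact j q := by
    rintro ⟨a, p⟩
    constructor
    · intro h
      have h' : f a + φ₀ p = 0 := by simpa [q] using h
      have hp : π p = 0 := by
        rw [← hφ₀', Submodule.Quotient.mk_eq_zero, eq_neg_of_add_eq_zero_right h', ← map_neg]
        exact ⟨_, rfl⟩
      obtain ⟨t, rfl⟩ := (hex p).1 hp
      refine ⟨-t, Prod.ext (hf ?_) (by simp [j])⟩
      simp [j, hφ₁, eq_neg_of_add_eq_zero_left h']
    · rintro ⟨t, ht⟩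
      rw [← ht]
      simp [j, q, hφ₁]
  -- By right exactness `(x, 0)` lifts to some `t` in `M ⊗ P₁`. Its components say that `φ₁` sends
  -- `t` to `x` and that `t` is a cycle, hence almost a boundary; `φ₁ ∘ d₂ = 0` then kills a small
  -- multiple of `x`.
  have hzero : q.lTensor M ((LinearMap.inl T A P₀).lTensor M x) = 0 := by
    rw [← LinearMap.comp_apply, ← LinearMap.lTensor_comp]
    simpa [q] using hx
  obtain ⟨t, ht⟩ := (lTensor_exact M hjq hq _).1 hzero
  have ht₁ : φ₁.lTensor M t = x := by
    have := congrArg ((LinearMap.fst T A P₀).lTensor M) ht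
    rw [← LinearMap.comp_apply, ← LinearMap.comp_apply, ← LinearMap.lTensor_comp,
      ← LinearMap.lTensor_comp] at this
    simpa [j] using this
  have ht₂ : d₁.lTensor M t = 0 := by
    have := congrArg ((LinearMap.snd T A P₀).lTensor M) ht
    rw [← LinearMap.comp_apply, ← LinearMap.comp_apply, ← LinearMap.lTensor_comp,
      ← LinearMap.lTensor_comp] at this
    simpa [j] using this
  obtain ⟨b, ⟨s, hs⟩, hv⟩ := hTor t ht₂ ε hε
  refine ⟨b, ?_, hv⟩
  rw [← ht₁, ← map_smul, ← hs, ← LinearMap.comp_apply, ← LinearMap.lTensor_comp, hcomp]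
  simp

/-- Tensoring with an almost flat module preserves almost exactness of complexes. -/
theorem IsAlmostFlat.almost_exact_lTensor (hM : IsAlmostFlat v M)
    {A B C : Type u} [AddCommGroup A] [Module T A] [AddCommGroup B] [Module T B]
    [AddCommGroup C] [Module T C] (f : A →ₗ[T] B) (g : B →ₗ[T] C) (hfg : g ∘ₗ f = 0)
    (h : ∀ z ∈ ker g, ∀ ε : ℝ, 0 < ε → ∃ b : T, b • z ∈ range f ∧ v b < (ε : WithTop ℝ))
    (z : M ⊗[T] B) (hz : z ∈ ker (g.lTensor M)) (ε : ℝ) (hε : 0 < ε) :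
    ∃ b : T, b • z ∈ range (f.lTensor M) ∧ v b < (ε : WithTop ℝ) := by
  have hH := (isAlmostZero_quotient_submoduleOf_iff (v := v) (ker g) (range f)).2 h
  let f' : A →ₗ[T] ker g := f.codRestrict (ker g) fun a => LinearMap.congr_fun hfg a
  have hquot : Function.Exact f' ((range f).submoduleOf (ker g)).mkQ := by
    intro y
    rw [Submodule.mkQ_apply, Submodule.Quotient.mk_eq_zero, Submodule.submoduleOf,
      Submodule.mem_comap]
    exact ⟨fun ⟨a, ha⟩ => ⟨a, Subtype.ext ha⟩, fun ⟨a, ha⟩ => ⟨a, congrArg Subtype.val ha⟩⟩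
  have hker : Function.Exact (ker g).subtype g.rangeRestrict := by
    intro y
    simp [← Subtype.val_inj]
  obtain ⟨b, hb, hbv⟩ := hM.exists_smul_eq_zero_of_lTensor_eq_zero (range g).subtype
    (Subtype.val_injective) (g.rangeRestrict.lTensor M z)
    (by
      rw [← LinearMap.comp_apply, ← LinearMap.lTensor_comp]
      exact hz) (ε / 2) (half_pos hε)
  rw [← map_smul] at hb
  obtain ⟨y, hy⟩ := (lTensor_exact M hker g.surjective_rangeRestrict _).1 hb
  obtain ⟨c, hc, hcv⟩ := hH.tensorProduct (((range f).submoduleOf (ker g)).mkQ.lTensor M y)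
    (ε / 2) (half_pos hε)
  rw [← map_smul] at hc
  obtain ⟨a, ha⟩ := (lTensor_exact M hquot (Submodule.mkQ_surjective _) _).1 hc
  refine ⟨c * b, ⟨a, ?_⟩, v.map_mul_lt hcv hbv⟩
  rw [mul_smul, ← hy, ← map_smul, ← ha, ← LinearMap.comp_apply, ← LinearMap.lTensor_comp]
  rfl

end AlmostFlat

/-! ### The Čech complex of `M` as a tensor product -/

section CechTensor

variable {T : Type u} [CommRing T] (M : Type u) [AddCommGroup M] [Module T M]

/-- The map `M → M ⊗ T_a`, `m ↦ m ⊗ 1`. -/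
noncomputable def toTensorLocAway (a : T) : M →ₗ[T] M ⊗[T] LocAway a T :=
  (LocalizedModule.mkLinearMap (Submonoid.powers a) T).lTensor M ∘ₗ
    (TensorProduct.rid T M).symm.toLinearMap

/-- Up to swapping the factors, this map is the base change to `M` of the localization `T → T_a`. -/
instance (a : T) : IsLocalizedModule (Submonoid.powers a) (toTensorLocAway M a) := by
  have h : toTensorLocAway M a = (TensorProduct.comm T (LocAway a T) M).toLinearMap ∘ₗ
      AlgebraTensorModule.rTensor T M (LocalizedModule.mkLinearMap (Submonoid.powers a) T) ∘ₗ
        (TensorProduct.lid T M).symm.toLinearMap := by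
    ext m
    simp [toTensorLocAway]
  rw [h]
  infer_instance

/-- The canonical isomorphism `M ⊗ T_a ≃ M_a`. -/
noncomputable def tensorLocAwayEquiv (a : T) : M ⊗[T] LocAway a T ≃ₗ[T] LocAway a M :=
  IsLocalizedModule.linearEquiv (Submonoid.powers a) (toTensorLocAway M a)
    (LocalizedModule.mkLinearMap (Submonoid.powers a) M)

theorem locAwayMap_mkLinearMap {a b : T} (h : a ∣ b) (N : Type u) [AddCommGroup N] [Module T N]
    (m : N) : locAwayMap h N (LocalizedModule.mkLinearMap (Submonoid.powers a) N m) =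
      LocalizedModule.mkLinearMap (Submonoid.powers b) N m := by
  simp [locAwayMap, LocalizedModule.lift_mk]

theorem tensorLocAwayEquiv_lTensor_locAwayMap {a b : T} (h : a ∣ b) (z : M ⊗[T] LocAway a T) :
    tensorLocAwayEquiv M b ((locAwayMap h T).lTensor M z) =
      locAwayMap h M (tensorLocAwayEquiv M a z) := by
  have : (tensorLocAwayEquiv M b).toLinearMap ∘ₗ (locAwayMap h T).lTensor M =
      locAwayMap h M ∘ₗ (tensorLocAwayEquiv M a).toLinearMap := by
    -- Multiplication by `a` is invertible on the target, so it suffices to compare both maps on the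
    -- image of `M`.
    apply IsLocalizedModule.ext (Submonoid.powers a) (toTensorLocAway M a)
      (isUnit_of_dvd_locAway h M)
    ext m
    have h₁ (c : T) : tensorLocAwayEquiv M c (toTensorLocAway M c m) =
        LocalizedModule.mkLinearMap (Submonoid.powers c) M m :=
      IsLocalizedModule.linearEquiv_apply _ _ _ _
    have h₂ : (locAwayMap h T).lTensor M (toTensorLocAway M a m) = toTensorLocAway M b m := by
      simp only [toTensorLocAway, LinearMap.comp_apply, LinearEquiv.coe_coe,
        TensorProduct.rid_symm_apply, LinearMap.lTensor_tmul, locAwayMap_mkLinearMap]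
    simp only [LinearMap.comp_apply, LinearEquiv.coe_coe, h₁, h₂, locAwayMap_mkLinearMap]
  exact LinearMap.congr_fun this z

variable {n : ℕ} (y : Fin n → T)

/-- The canonical isomorphism of `M ⊗ C^p(T)` with `C^p(M)`, for `C^p` the terms of the Čech
complex. -/
noncomputable def tensorCechEquiv (p : ℕ) : M ⊗[T] CechTerm y T p ≃ₗ[T] CechTerm y M p :=
  -- The index set is finite, so `M ⊗ -` commutes with the product.
  TensorProduct.piRight T T M _ ≪≫ₗ LinearEquiv.piCongrRight fun _ => tensorLocAwayEquiv M _

theorem tensorCechEquiv_tmul (p : ℕ) (m : M) (f : CechTerm y T p)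
    (s : {s : Finset (Fin n) // s.card = p}) :
    tensorCechEquiv M y p (m ⊗ₜ f) s = tensorLocAwayEquiv M _ (m ⊗ₜ f s) := by
  simp [tensorCechEquiv]

theorem tensorCechEquiv_lTensor_cechDiff (p : ℕ) (z : M ⊗[T] CechTerm y T p) :
    tensorCechEquiv M y (p + 1) ((cechDiff y T p).lTensor M z) =
      cechDiff y M p (tensorCechEquiv M y p z) := by
  induction z with
  | zero => simp only [map_zero]
  | add z w hz hw => simp only [map_add, hz, hw]
  | tmul m f =>
    funext s
    rw [LinearMap.lTensor_tmul, tensorCechEquiv_tmul, cechDiff_apply, cechDiff_apply,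
      TensorProduct.tmul_sum, map_sum]
    refine Finset.sum_congr rfl fun i _ => ?_
    rw [TensorProduct.tmul_smul, map_smul, tensorCechEquiv_tmul,
      ← tensorLocAwayEquiv_lTensor_locAwayMap, LinearMap.lTensor_tmul]

theorem IsAlmostFlat.isAlmostZero_cechCohomology {v : ValueMap T} {M : Type u} [AddCommGroup M]
    [Module T M] (hM : IsAlmostFlat v M) (p : ℕ) (h : IsAlmostZero v (CechCohomology y T p)) :
    IsAlmostZero v (CechCohomology y M p) := by
  rw [isAlmostZero_quotient_submoduleOf_iff] at h ⊢
  intro z hz ε hε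
  obtain ⟨z, rfl⟩ := (tensorCechEquiv M y p).surjective z
  rw [LinearMap.mem_ker, ← tensorCechEquiv_lTensor_cechDiff,
    LinearEquiv.map_eq_zero_iff] at hz
  cases p with
  | zero =>
    -- In degree `0` the boundaries are `⊥`, realised as the range of the zero map from a trivial
    -- module.
    obtain ⟨b, ⟨w, hw⟩, hv⟩ := hM.almost_exact_lTensor (0 : PUnit.{u + 1} →ₗ[T] CechTerm y T 0)
      (cechDiff y T 0) (LinearMap.comp_zero _)
      (by simpa only [cechBoundaries, LinearMap.range_zero] using h) z hz ε hε
    refine ⟨b, ?_, hv⟩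
    rw [LinearMap.lTensor_zero, LinearMap.zero_apply] at hw
    rw [← map_smul, ← hw, map_zero]
    exact Submodule.zero_mem _
  | succ p =>
    obtain ⟨b, ⟨w, hw⟩, hv⟩ := hM.almost_exact_lTensor (cechDiff y T p) (cechDiff y T (p + 1))
      (LinearMap.ext fun f => cechDiff_cechDiff y T p f) h z hz ε hε
    refine ⟨b, ⟨tensorCechEquiv M y p w, ?_⟩, hv⟩
    rw [← tensorCechEquiv_lTensor_cechDiff, hw, map_smul]

end CechTensor

theorem IsAlmostFaithfullyFlat.isAlmostZero_quotient {T : Type u} [CommRing T] {v : ValueMap T}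
    {M : Type u} [AddCommGroup M] [Module T M] (hM : IsAlmostFaithfullyFlat v M) (I : Ideal T)
    (h : IsAlmostZero v (M ⧸ (I • (⊤ : Submodule T M)))) :
    IsAlmostZero v (T ⧸ (I • (⊤ : Submodule T T))) := by
  let e := (Submodule.quotEquivOfEq (I • (⊤ : Submodule T T)) I
    (by rw [smul_eq_mul, Ideal.mul_top])).symm
  have : IsAlmostZero v (T ⧸ I) :=
    hM.2 _ (h.of_surjective (tensorQuotEquivQuotSMul M I).symm.toLinearMap
      (tensorQuotEquivQuotSMul M I).symm.surjective)
  exact this.of_surjective e.toLinearMap e.surjective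

theorem theorem6p3 {R : Type w} [CommRing R] [IsLocalRing R] [IsNoetherianRing R]
    {T : Type u} [CommRing T] [Algebra R T] (v : ValueMap T)
    {n : ℕ} (x : Fin n → R)
    (hx : (Ideal.span (Set.range x)).radical = IsLocalRing.maximalIdeal R)
    (hT : IsAlmostCohenMacaulay R v x T)
    (M : Type u) [AddCommGroup M] [Module T M] (hM : IsAlmostFaithfullyFlat v M) :
    IsAlmostCohenMacaulay R v x M :=
  ⟨fun i hi => hM.1.isAlmostZero_cechCohomology _ i (hT.1 i hi),
    fun h => hT.2 (hM.isAlmostZero_quotient _ h)⟩
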